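/- Let $X$ be a $\mathcal D_1$-space: a set with a maximal atlas $\Phi$ of charts $k:U\to X$, where $U\subset\mathbb R$ is open, $k$ is an arbitrary map, morphisms of charts are the étale ($C^\infty$, with nowhere vanishing derivative) maps of the domains commuting with the maps to $X$, and $X$ is the colimit of the chart domains over all these morphisms. For $2\le N\le\infty$ and open $U\subset\mathbb R$ let $S_N(U)$ be the space of $N$-jets at $0$ of maps $f:\mathbb R\to U$ regular at $0$, with coordinates $z_p=f^{(p)}(0)$, $0\le p\le N$, on which $\lambda\in\mathrm{GL}(1)=\mathbb R^*$ acts by $z_p\mapsto\lambda^pz_p$. Put $S'_N(U)=S_N(U)/\mathrm{GL}(1)$, with coordinates $x_0=z_0$, $x_p=z_p/z_1^p$ $(p\ge2)$, and $S''_N(U)=S_N(U)/\mathrm O(1)$, with the additional coordinate $x_1=\ln|z_1|$; let $n\in\mathbb Z$ act on $S''_N(U)$ by $x_1\mapsto x_1+n$. Étale maps $h$ act on these spaces by $f\mapsto h\circ f$. Let $\Omega^k(S'_N(X))$ (respectively $\Omega^k(S''_N(X)/\mathbb Z)$) be the space of families, indexed by the charts $(U,k)\in\Phi$, of smooth $k$-forms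 on $S'_N(U)$ (respectively of $\mathbb Z$-invariant smooth $k$-forms on $S''_N(U)$) that are compatible with pullback along the maps induced by all morphisms of charts; for $N=\infty$ a smooth form is locally the pullback of a smooth form in finitely many coordinates. Let $H^*(S'_N(X))$ and $H^*(S''_N(X)/\mathbb Z)$ be the cohomology of these complexes with respect to the exterior derivative, and write $S'=S'_\infty$, $S''=S''_\infty$. Let $\theta_0,\theta_1,\theta_2$ be the canonical $1$-forms on the frame space $S_\infty$, defined by $$-\frac{\sum_{p\ge0}dz_p\,t^p/p!}{\sum_{p\ge0}z_{p+1}\,t^p/p!}=\sum_{k\ge0}\theta_k\frac{t^k}{k!}.$$ The form $\theta_2\wedge\theta_0$ descends to the closed form $dx_2\wedge dx_0$, which defines the first Chern–Losik (CL) class of $X$ in $H^2(S'_N(X))$, and $\theta_0\wedge\theta_1\wedge\theta_2$ descends to the closed form $-dx_0\wedge dx_1\wedge dx_2$, which defines the Godbillon–Vey–Losik (GVL) class of $X$ in $H^3(S''_N(X)/\mathbb Z)$. Proposition. If the first CL class of $X$ is trivial in $H^2(S'_2(X))$, then it is trivial in $H^2(S'(X))$; moreover, the GVL class is then trivial in $H^3(S''_2(X)/\mathbb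 Z)$, and hence also in $H^3(S''(X)/\mathbb Z)$. -/

import Mathlib

open scoped ContDiff Nat

namespace Losik

universe u

/-! ### One-dimensional étale maps, charts and `D₁`-spaces -/

/-- An étale (regular) map between open subsets `U`, `V` of the line. Only the values on `U`
matter. -/
structure EtaleMap (U V : TopologicalSpace.Opens ℝ) where
  toFun : ℝ → ℝ
  mapsTo : ∀ t ∈ U, toFun t ∈ V
  contDiffOn : ContDiffOn ℝ ∞ toFun U
  deriv_ne_zero : ∀ t ∈ U, deriv toFun t ≠ 0

/-- A `D₁`-chart on a set `X`: an open subset of the line together with an arbitrary map to `X`. -/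
structure Chart (X : Type u) where
  dom : TopologicalSpace.Opens ℝ
  toFun : dom → X

/-- A morphism of charts: an étale map of the domains that commutes with the maps to `X`. -/
structure Chart.Hom {X : Type u} (c d : Chart X) extends EtaleMap c.dom d.dom where
  comm : ∀ t : c.dom, d.toFun ⟨toFun t, mapsTo t t.2⟩ = c.toFun t

/-- The disjoint union of the domains of the charts in `Φ`. -/
abbrev ChartPoint {X : Type u} (Φ : Set (Chart X)) : Type u := Σ c : Φ, c.1.dom

/-- The relation that generates the colimit: a morphism of charts carries one point to the other. -/
def ChartPoint.Step {X : Type u} (Φ : Set (Chart X)) (p q : ChartPoint Φ) : Prop :=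
  ∃ m : Chart.Hom p.1.1 q.1.1, m.toFun p.2 = q.2

/-- The colimit, in the category of sets, of the domains of the charts in `Φ` over all morphisms
of charts. -/
def ChartColimit {X : Type u} (Φ : Set (Chart X)) : Type u := Quot (ChartPoint.Step Φ)

/-- The canonical map from the colimit of the chart domains to `X`. -/
def ChartColimit.toSpace {X : Type u} (Φ : Set (Chart X)) : ChartColimit Φ → X :=
  Quot.lift (fun p => p.1.1.toFun p.2) (by
    rintro p q ⟨m, hm⟩
    rw [← m.comm p.2]
    exact congrArg _ (Subtype.ext hm))

/-- `Φ` is a `D₁`-atlas on `X`: the set `X` is the colimit of the domains of the charts. -/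
def IsAtlas {X : Type u} (Φ : Set (Chart X)) : Prop :=
  Function.Bijective (ChartColimit.toSpace Φ)

/-- A `D₁`-space structure on the set `X`: a maximal `D₁`-atlas. -/
structure D1Space (X : Type u) where
  charts : Set (Chart X)
  maximal : Maximal IsAtlas charts

/-! ### Differential forms on open subsets of `ℝ^ι`, with `ι` finite or infinite

A `k`-form is given by its values on `k`-tuples of tangent vectors; on an infinite product
it must locally be the pullback of a smooth form in finitely many coordinates. Values outside the
open set under consideration play no role. -/

/-- Fields of functions of `k` tangent vectors on `ℝ^ι` (no regularity, no linearity yet). -/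
abbrev Form (ι : Type) (k : ℕ) : Type := (ι → ℝ) → (Fin k → ι → ℝ) → ℝ

/-- The projection of `ℝ^ι` onto finitely many coordinates. -/
def restrict {ι : Type} (s : Finset ι) (x : ι → ℝ) : s → ℝ := fun i => x i

/-- `σ` is a smooth differential `k`-form on `W`: near each point of `W` it is the pullback of a
smooth field of alternating forms in finitely many coordinates. -/
def IsSmoothOn {ι : Type} {k : ℕ} (σ : Form ι k) (W : Set (ι → ℝ)) : Prop :=
  ∀ x ∈ W, ∃ (s : Finset ι) (O : Set (s → ℝ)) (η : (s → ℝ) → (s → ℝ) [⋀^Fin k]→ₗ[ℝ] ℝ),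
    IsOpen O ∧ restrict s x ∈ O ∧ (∀ v, ContDiffOn ℝ ∞ (fun y => η y v) O) ∧
    ∀ y ∈ W, restrict s y ∈ O → ∀ v, σ y v = η (restrict s y) (fun i => restrict s (v i))

/-- The exterior derivative
`dσ(v₀,…,v_k) = ∑ (-1)^i D_{v_i} σ(v₀,…,v̂_i,…,v_k)` (constant vector fields `v_i`). -/
noncomputable def extD {ι : Type} {k : ℕ} (σ : Form ι k) : Form ι (k + 1) := fun x v =>
  ∑ i : Fin (k + 1), (-1) ^ (i : ℕ) *
    lineDeriv ℝ (fun y => σ y (fun j => v (i.succAbove j))) x (v i)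

/-- The differential of a map `ℝ^ι → ℝ^κ` at `x`, applied to `v`, computed coordinatewise. -/
noncomputable def tangent {ι κ : Type} (f : (ι → ℝ) → κ → ℝ) (x v : ι → ℝ) : κ → ℝ :=
  fun p => lineDeriv ℝ (fun y => f y p) x v

/-- The pullback of a form. -/
noncomputable def pullback {ι κ : Type} {k : ℕ} (f : (ι → ℝ) → κ → ℝ) (σ : Form κ k) :
    Form ι k :=
  fun x v => σ (f x) (fun i => tangent f x (v i))

/-- The exterior product `α₀ ∧ ⋯ ∧ α_{k-1}` of one-forms. -/
noncomputable def wedge {ι : Type} {k : ℕ} (α : Fin k → Form ι 1) : Form ι k := fun x v =>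
  Matrix.det (Matrix.of fun i j => α i x (fun _ => v j))

/-! ### Frames of higher order

The infinite order frame at `0` represented by a regular map `f` has the coordinates
`z_p = f^{(p)}(0)`; thus the frames of an open set `U` are the sequences `z` with `z 0 ∈ U` and
`z 1 ≠ 0`. -/

/-- The polynomial map whose `n`-jet at `0` has the coordinates `z₀,…,z_n`. -/
noncomputable def taylorRep (z : ℕ → ℝ) (n : ℕ) (t : ℝ) : ℝ :=
  ∑ q ∈ Finset.range (n + 1), z q / (q ! : ℝ) * t ^ q

/-- The map of frames induced by `h`: the jet of `f` goes to the jet of `h ∘ f`. The `n`-th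
derivative of `h ∘ f` at `0` depends only on the `n`-jet of `f`. -/
noncomputable def prolong (h : ℝ → ℝ) (z : ℕ → ℝ) : ℕ → ℝ :=
  fun n => iteratedDeriv n (fun t => h (taylorRep z n t)) 0

/-- The coordinates `x₀ = z₀`, `x₁ = log |z₁|`, `x_p = z_p / z₁^p` (`p ≥ 2`). All of them are
coordinates on the quotient of the frames by `O(1)`; all but `x₁` are coordinates on the
quotient by `GL(1)`, where `λ ∈ GL(1)` acts by `z_p ↦ λ^p z_p`. -/
noncomputable def toCoord (z : ℕ → ℝ) : ℕ → ℝ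
  | 0 => z 0
  | 1 => Real.log |z 1|
  | p + 2 => z (p + 2) / z 1 ^ (p + 2)

/-- The frame with `z₁ > 0` and prescribed coordinates `x₀, x₁, x₂, …`. -/
noncomputable def ofCoord (x : ℕ → ℝ) : ℕ → ℝ
  | 0 => x 0
  | 1 => Real.exp (x 1)
  | p + 2 => x (p + 2) * Real.exp (x 1) ^ (p + 2)

/-- Extension by zero of a family of coordinates indexed by `I ⊆ ℕ`. -/
noncomputable def extend {I : Set ℕ} (x : I → ℝ) : ℕ → ℝ :=
  open Classical in fun p => if h : p ∈ I then x ⟨p, h⟩ else 0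

/-- A frame that lies over the point of the quotient with the coordinates `x_p`, `p ∈ I`. -/
noncomputable def frameSection {I : Set ℕ} (x : I → ℝ) : ℕ → ℝ := ofCoord (extend x)

/-- The map of quotients of frame spaces induced by `h`, in the coordinates `x_p`, `p ∈ I`. -/
noncomputable def induced (I : Set ℕ) (h : ℝ → ℝ) (x : I → ℝ) : I → ℝ :=
  fun p => toCoord (prolong h (frameSection x)) p

/-- The coordinate domain that is the quotient of the frames over `U`. -/
def frameDom (I : Set ℕ) (U : TopologicalSpace.Opens ℝ) : Set (I → ℝ) := {x | extend x 0 ∈ U}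

/-- The translation `x₁ ↦ x₁ + a` (trivial if `x₁` is not among the coordinates); it is the action
of `e^a ∈ GL(1)`. -/
noncomputable def shift {I : Set ℕ} (a : ℝ) (x : I → ℝ) : I → ℝ :=
  fun p => x p + if (p : ℕ) = 1 then a else 0

/-- The kinds of quotients of frame spaces that are used: the coordinates that remain, and the
discrete group of translations of `x₁` by which one divides. -/
structure FrameQuotient where
  coords : Set ℕ
  deck : AddSubgroup ℝ

/-- `S'_N`: frames of order `N ≤ ∞` modulo `GL(1)`, with the coordinates `x₀, x₂, x₃, …`. -/
def SPrime (N : ℕ∞) : FrameQuotient := ⟨{p | (p : ℕ∞) ≤ N ∧ p ≠ 1}, ⊥⟩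

/-- `S''_N / ℤ`: frames of order `N ≤ ∞` modulo `O(1)`, with the coordinates `x₀, x₁, x₂, …`,
divided by the action `x₁ ↦ x₁ + n` of `ℤ`. -/
def SDoublePrimeModZ (N : ℕ∞) : FrameQuotient :=
  ⟨{p | (p : ℕ∞) ≤ N}, AddSubgroup.zmultiples 1⟩

/-! ### Facts on smooth forms -/

theorem restrict_add_smul {ι : Type} (s : Finset ι) (x v : ι → ℝ) (t : ℝ) :
    restrict s (x + t • v) = restrict s x + t • restrict s v := rfl

theorem IsSmoothOn.zero {ι : Type} {k : ℕ} (W : Set (ι → ℝ)) : IsSmoothOn (0 : Form ι k) W :=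
  fun _ _ => ⟨∅, Set.univ, 0, isOpen_univ, trivial, fun _ => contDiffOn_const, fun _ _ _ _ => rfl⟩

theorem IsSmoothOn.smul {ι : Type} {k : ℕ} {W : Set (ι → ℝ)} {σ : Form ι k} (a : ℝ)
    (h : IsSmoothOn σ W) : IsSmoothOn (a • σ) W := by
  intro x hx
  obtain ⟨s, O, η, hO, hxO, hη, he⟩ := h x hx
  refine ⟨s, O, fun y => a • η y, hO, hxO, fun v => ?_, fun y hy hyO v => ?_⟩
  · simpa using contDiffOn_const.mul (hη v)
  · simp [he y hy hyO v]

/-- Restriction of coordinates from one finite set to a smaller one. -/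
def restrictLin {ι : Type} {s t : Finset ι} (h : s ⊆ t) : (t → ℝ) →ₗ[ℝ] (s → ℝ) where
  toFun x := fun i => x ⟨i, h i.2⟩
  map_add' _ _ := rfl
  map_smul' _ _ := rfl

theorem restrictLin_contDiff {ι : Type} {s t : Finset ι} (h : s ⊆ t) :
    ContDiff ℝ ∞ (restrictLin h) :=
  contDiff_pi.2 fun i => contDiff_apply ℝ ℝ (⟨i, h i.2⟩ : t)

theorem IsSmoothOn.add {ι : Type} {k : ℕ} {W : Set (ι → ℝ)} {σ σ' : Form ι k}
    (h : IsSmoothOn σ W) (h' : IsSmoothOn σ' W) : IsSmoothOn (σ + σ') W := by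
  classical
  intro x hx
  obtain ⟨s, O, η, hO, hxO, hη, he⟩ := h x hx
  obtain ⟨s', O', η', hO', hxO', hη', he'⟩ := h' x hx
  have hs : s ⊆ s ∪ s' := Finset.subset_union_left
  have hs' : s' ⊆ s ∪ s' := Finset.subset_union_right
  refine ⟨s ∪ s', restrictLin hs ⁻¹' O ∩ restrictLin hs' ⁻¹' O',
    fun y => (η (restrictLin hs y)).compLinearMap (restrictLin hs) +
      (η' (restrictLin hs' y)).compLinearMap (restrictLin hs'), ?_, ⟨hxO, hxO'⟩, fun v => ?_,
    fun y hy hyO v => ?_⟩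
  · exact (hO.preimage (restrictLin_contDiff hs).continuous).inter
      (hO'.preimage (restrictLin_contDiff hs').continuous)
  · refine ContDiffOn.add ?_ ?_
    · exact ((hη _).comp (restrictLin_contDiff hs).contDiffOn fun y hy => hy.1)
    · exact ((hη' _).comp (restrictLin_contDiff hs').contDiffOn fun y hy => hy.2)
  · have h1 := he y hy hyO.1 v
    have h2 := he' y hy hyO.2 v
    simp only [Pi.add_apply, h1, h2]
    rfl

theorem IsSmoothOn.lineDifferentiableAt {ι : Type} {k : ℕ} {W : Set (ι → ℝ)} {σ : Form ι k}
    (hW : IsOpen W) (h : IsSmoothOn σ W) {x : ι → ℝ} (hx : x ∈ W) (v : Fin k → ι → ℝ)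
    (w : ι → ℝ) : LineDifferentiableAt ℝ (fun y => σ y v) x w := by
  obtain ⟨s, O, η, hO, hxO, hη, he⟩ := h x hx
  have hline : Continuous fun t : ℝ => x + t • w := by fun_prop
  have hline' : Continuous fun t : ℝ => restrict s x + t • restrict s w := by fun_prop
  have h1 : ∀ᶠ t in nhds (0 : ℝ), x + t • w ∈ W :=
    hline.continuousAt.eventually (by simpa using hW.mem_nhds hx)
  have h2 : ∀ᶠ t in nhds (0 : ℝ), restrict s x + t • restrict s w ∈ O :=
    hline'.continuousAt.eventually (by simpa using hO.mem_nhds hxO)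
  have hd : DifferentiableAt ℝ (fun t : ℝ =>
      η (restrict s x + t • restrict s w) (fun i => restrict s (v i))) 0 := by
    have hc := ((hη (fun i => restrict s (v i))).differentiableOn (by simp)).differentiableAt
      (x := restrict s x + (0 : ℝ) • restrict s w) (by simpa using hO.mem_nhds hxO)
    have hl : DifferentiableAt ℝ (fun t : ℝ => restrict s x + t • restrict s w) 0 := by fun_prop
    exact DifferentiableAt.comp (0 : ℝ) hc hl
  refine hd.congr_of_eventuallyEq ?_
  filter_upwards [h1, h2] with t ht1 ht2
  exact he _ ht1 ht2 v

theorem extD_zero {ι : Type} {k : ℕ} : extD (0 : Form ι k) = 0 := by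
  funext x v
  simp [extD, lineDeriv]

theorem extD_smul {ι : Type} {k : ℕ} (a : ℝ) (σ : Form ι k) : extD (a • σ) = a • extD σ := by
  funext x v
  simp only [extD, lineDeriv, Pi.smul_apply, smul_eq_mul, Finset.mul_sum,
    deriv_const_mul_field']
  exact Finset.sum_congr rfl fun i _ => by ring

theorem extD_add {ι : Type} {k : ℕ} {W : Set (ι → ℝ)} (hW : IsOpen W) {σ σ' : Form ι k}
    (h : IsSmoothOn σ W) (h' : IsSmoothOn σ' W) {x : ι → ℝ} (hx : x ∈ W)
    (v : Fin (k + 1) → ι → ℝ) : extD (σ + σ') x v = extD σ x v + extD σ' x v := by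
  simp only [extD, ← Finset.sum_add_distrib]
  refine Finset.sum_congr rfl fun i _ => ?_
  rw [← mul_add]
  congr 1
  exact deriv_add (h.lineDifferentiableAt hW hx _ _) (h'.lineDifferentiableAt hW hx _ _)

theorem isOpen_frameDom (I : Set ℕ) (U : TopologicalSpace.Opens ℝ) : IsOpen (frameDom I U) := by
  refine U.isOpen.preimage ?_
  unfold extend
  split_ifs <;> fun_prop

/-! ### The de Rham complex and cohomology of the frame spaces of a `D₁`-space -/

section Cohomology

variable {X : Type u}

/-- The space `Ω^k` of the quotient `B` of the frame space of a `D₁`-space: families of smooth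
`k`-forms on the coordinate domains over all charts, which are compatible with the maps induced by
the morphisms of charts and invariant under the discrete group. -/
noncomputable def forms (A : D1Space X) (B : FrameQuotient) (k : ℕ) :
    Submodule ℝ (A.charts → Form B.coords k) where
  carrier := {σ |
    (∀ c, IsSmoothOn (σ c) (frameDom B.coords c.1.dom)) ∧
    (∀ (c d : A.charts) (m : Chart.Hom c.1 d.1), ∀ x ∈ frameDom B.coords c.1.dom, ∀ v,
      pullback (induced B.coords m.toFun) (σ d) x v = σ c x v) ∧
    ∀ c, ∀ a ∈ B.deck, ∀ x ∈ frameDom B.coords c.1.dom, ∀ v, σ c (shift a x) v = σ c x v}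
  zero_mem' := ⟨fun _ => IsSmoothOn.zero _, fun _ _ _ _ _ _ => rfl, fun _ _ _ _ _ _ => rfl⟩
  add_mem' := by
    rintro σ σ' ⟨h1, h2, h3⟩ ⟨h1', h2', h3'⟩
    refine ⟨fun c => (h1 c).add (h1' c), fun c d m x hx v => ?_, fun c a ha x hx v => ?_⟩
    · exact congrArg₂ (· + ·) (h2 c d m x hx v) (h2' c d m x hx v)
    · exact congrArg₂ (· + ·) (h3 c a ha x hx v) (h3' c a ha x hx v)
  smul_mem' := by
    rintro a σ ⟨h1, h2, h3⟩
    refine ⟨fun c => (h1 c).smul a, fun c d m x hx v => ?_, fun c b hb x hx v => ?_⟩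
    · exact congrArg (a * ·) (h2 c d m x hx v)
    · exact congrArg (a * ·) (h3 c b hb x hx v)

/-- The closed `k`-forms. -/
noncomputable def closedForms (A : D1Space X) (B : FrameQuotient) (k : ℕ) :
    Submodule ℝ (A.charts → Form B.coords k) where
  carrier := {σ | σ ∈ forms A B k ∧
    ∀ c, ∀ x ∈ frameDom B.coords c.1.dom, ∀ v, extD (σ c) x v = 0}
  zero_mem' := ⟨zero_mem _, fun c x _ v => congrFun (congrFun extD_zero x) v⟩
  add_mem' := by
    rintro σ σ' ⟨h, hd⟩ ⟨h', hd'⟩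
    refine ⟨add_mem h h', fun c x hx v => ?_⟩
    rw [Pi.add_apply, extD_add (isOpen_frameDom _ _) (h.1 c) (h'.1 c) hx, hd c x hx v,
      hd' c x hx v, add_zero]
  smul_mem' := by
    rintro a σ ⟨h, hd⟩
    refine ⟨Submodule.smul_mem _ a h, fun c x hx v => ?_⟩
    rw [Pi.smul_apply, extD_smul, Pi.smul_apply, Pi.smul_apply, hd c x hx v, smul_zero]

/-- The exact `(k+1)`-forms: the differentials of `k`-forms. -/
noncomputable def exactForms (A : D1Space X) (B : FrameQuotient) (k : ℕ) :
    Submodule ℝ (A.charts → Form B.coords (k + 1)) where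
  carrier := {σ | σ ∈ forms A B (k + 1) ∧ ∃ η ∈ forms A B k,
    ∀ c, ∀ x ∈ frameDom B.coords c.1.dom, ∀ v, extD (η c) x v = σ c x v}
  zero_mem' := ⟨zero_mem _, 0, zero_mem _, fun c x _ v => congrFun (congrFun extD_zero x) v⟩
  add_mem' := by
    rintro σ σ' ⟨h, η, hη, hd⟩ ⟨h', η', hη', hd'⟩
    refine ⟨add_mem h h', η + η', add_mem hη hη', fun c x hx v => ?_⟩
    rw [Pi.add_apply, extD_add (isOpen_frameDom _ _) (hη.1 c) (hη'.1 c) hx, hd c x hx v,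
      hd' c x hx v]
    rfl
  smul_mem' := by
    rintro a σ ⟨h, η, hη, hd⟩
    refine ⟨Submodule.smul_mem _ a h, a • η, Submodule.smul_mem _ a hη, fun c x hx v => ?_⟩
    rw [Pi.smul_apply, extD_smul, Pi.smul_apply, Pi.smul_apply, hd c x hx v]
    rfl

/-- The de Rham cohomology `H^{k+1}` of the quotient `B` of the frame space of a `D₁`-space. -/
abbrev Cohomology (A : D1Space X) (B : FrameQuotient) (k : ℕ) : Type u :=
  closedForms A B (k + 1) ⧸ (exactForms A B k).submoduleOf (closedForms A B (k + 1))

end Cohomology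

/-! ### The canonical forms -/

/-- The canonical one-form `θ_k` on the space of infinite order frames. If `z(u)` is a curve of
frames, represented by maps `f_u`, with tangent vector `τ`, then
`-d/du (f₀⁻¹ ∘ f_u)(t) = -(∑ τ_p t^p / p!) / f₀'(t) = ∑ θ_k(τ) t^k / k!`. -/
noncomputable def theta (k : ℕ) : Form ℕ 1 := fun z v =>
  -((k ! : ℝ) * PowerSeries.coeff k
    (PowerSeries.mk (fun p => v 0 p / (p ! : ℝ)) *
      (PowerSeries.mk (fun p => z (p + 1) / (p ! : ℝ)))⁻¹))

/-- The form `θ₂ ∧ θ₀` descended to the quotient with the coordinates `x_p`, `p ∈ I`: the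
pullback along a section. -/
noncomputable def cl1Form (I : Set ℕ) : Form I 2 := pullback frameSection (wedge ![theta 2, theta 0])

/-- The form `θ₀ ∧ θ₁ ∧ θ₂` descended to the quotient with the coordinates `x_p`, `p ∈ I`: the
pullback along a section. -/
noncomputable def gvlForm (I : Set ℕ) : Form I 3 :=
  pullback frameSection (wedge ![theta 0, theta 1, theta 2])

open PowerSeries in
theorem invCoeff_zero (f : PowerSeries ℝ) : coeff 0 f⁻¹ = (coeff 0 f)⁻¹ := by
  simp

open PowerSeries in
theorem invCoeff_one (f : PowerSeries ℝ) :
    coeff 1 f⁻¹ = -(coeff 0 f)⁻¹ ^ 2 * coeff 1 f := by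
  rw [PowerSeries.coeff_inv]
  simp [Finset.Nat.antidiagonal_succ]
  ring

open PowerSeries in
theorem invCoeff_two (f : PowerSeries ℝ) :
    coeff 2 f⁻¹ = (coeff 0 f)⁻¹ ^ 3 * coeff 1 f ^ 2 - (coeff 0 f)⁻¹ ^ 2 * coeff 2 f := by
  rw [PowerSeries.coeff_inv]
  simp [Finset.Nat.antidiagonal_succ, invCoeff_one]
  ring

theorem theta_zero (z : ℕ → ℝ) (v : Fin 1 → ℕ → ℝ) : theta 0 z v = -(v 0 0 / z 1) := by
  simp [theta, PowerSeries.coeff_mul, div_eq_mul_inv]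

theorem theta_one (z : ℕ → ℝ) (v : Fin 1 → ℕ → ℝ) :
    theta 1 z v = -(v 0 1 / z 1) + z 2 / z 1 ^ 2 * v 0 0 := by
  simp [theta, PowerSeries.coeff_mul, Finset.Nat.antidiagonal_succ, invCoeff_zero,
    invCoeff_one, -PowerSeries.coeff_zero_eq_constantCoeff]
  ring

theorem theta_two (z : ℕ → ℝ) (v : Fin 1 → ℕ → ℝ) :
    theta 2 z v = -(v 0 2 / z 1) + 2 * z 2 / z 1 ^ 2 * v 0 1 +
      (z 3 / z 1 ^ 2 - 2 * z 2 ^ 2 / z 1 ^ 3) * v 0 0 := by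
  simp [theta, PowerSeries.coeff_mul, Finset.Nat.antidiagonal_succ, invCoeff_zero,
    invCoeff_one, invCoeff_two, -PowerSeries.coeff_zero_eq_constantCoeff, Nat.factorial]
  ring

/-! ### The characteristic forms in coordinates and their invariance -/

theorem extend_add_smul {I : Set ℕ} (x v : I → ℝ) (t : ℝ) (p : ℕ) :
    extend (x + t • v) p = extend x p + t * extend v p := by
  unfold extend
  split_ifs <;> simp

theorem hasDerivAt_extend {I : Set ℕ} (x v : I → ℝ) (p : ℕ) :
    HasDerivAt (fun t : ℝ => extend (x + t • v) p) (extend v p) 0 := by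
  simp only [extend_add_smul]
  simpa using ((hasDerivAt_id (0 : ℝ)).mul_const (extend v p)).const_add (extend x p)

theorem tangent_frameSection_zero {I : Set ℕ} (x v : I → ℝ) :
    tangent frameSection x v 0 = extend v 0 :=
  (hasDerivAt_extend x v 0).deriv

theorem tangent_frameSection_one {I : Set ℕ} (x v : I → ℝ) :
    tangent frameSection x v 1 = Real.exp (extend x 1) * extend v 1 := by
  have h := (hasDerivAt_extend x v 1).exp.deriv
  refine Eq.trans h ?_
  simp

theorem tangent_frameSection_two {I : Set ℕ} (x v : I → ℝ) :
    tangent frameSection x v 2 = Real.exp (extend x 1) ^ 2 * extend v 2 +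
      2 * extend x 2 * Real.exp (extend x 1) ^ 2 * extend v 1 := by
  have h := ((hasDerivAt_extend x v 2).mul ((hasDerivAt_extend x v 1).exp.pow 2)).deriv
  refine Eq.trans h ?_
  simp
  ring

/-- `θ₂ ∧ θ₀` is `dx₂ ∧ dx₀` in the coordinates of the quotient. -/
theorem cl1Form_apply {I : Set ℕ} (x : I → ℝ) (v : Fin 2 → I → ℝ) :
    cl1Form I x v = extend (v 0) 2 * extend (v 1) 0 - extend (v 1) 2 * extend (v 0) 0 := by
  have he := (Real.exp_pos (extend x 1)).ne'
  simp only [cl1Form, pullback, wedge, Matrix.det_fin_two, Matrix.of_apply, Matrix.cons_val_zero,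
    Matrix.cons_val_one, theta_zero, theta_two, tangent_frameSection_zero,
    tangent_frameSection_one, tangent_frameSection_two]
  simp only [frameSection, ofCoord]
  field_simp
  ring

/-- `θ₀ ∧ θ₁ ∧ θ₂` is `-dx₀ ∧ dx₁ ∧ dx₂` in the coordinates of the quotient. -/
theorem gvlForm_apply {I : Set ℕ} (x : I → ℝ) (v : Fin 3 → I → ℝ) :
    gvlForm I x v = -Matrix.det (Matrix.of fun i j : Fin 3 => extend (v j) i) := by
  have he := (Real.exp_pos (extend x 1)).ne'
  simp only [gvlForm, pullback, wedge, Matrix.det_fin_three, Matrix.of_apply,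
    Matrix.cons_val_zero, Matrix.cons_val_one, Matrix.cons_val, theta_zero, theta_one, theta_two,
    tangent_frameSection_zero, tangent_frameSection_one, tangent_frameSection_two,
    Fin.val_zero, Fin.val_one, Fin.val_two]
  simp only [frameSection, ofCoord]
  field_simp
  ring

theorem taylorRep_at_zero (z : ℕ → ℝ) (n : ℕ) : taylorRep z n 0 = z 0 := by
  simp [taylorRep, Finset.sum_range_succ']

theorem prolong_zero (h : ℝ → ℝ) (z : ℕ → ℝ) : prolong h z 0 = h (z 0) := by
  simp [prolong, taylorRep_at_zero]

theorem prolong_one {U : TopologicalSpace.Opens ℝ} {h : ℝ → ℝ} (hh : ContDiffOn ℝ ∞ h U)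
    {z : ℕ → ℝ} (hz : z 0 ∈ U) : prolong h z 1 = deriv h (z 0) * z 1 := by
  have hd : DifferentiableAt ℝ h (z 0) :=
    (hh.contDiffAt (U.isOpen.mem_nhds hz)).differentiableAt (by simp)
  have hp : HasDerivAt (fun t => z 0 + z 1 * t) (z 1) 0 := by
    simpa using ((hasDerivAt_id (0 : ℝ)).const_mul (z 1)).const_add (z 0)
  have he : (fun t => h (taylorRep z 1 t)) = h ∘ fun t => z 0 + z 1 * t := by
    funext t
    simp [taylorRep, Finset.sum_range_succ]
  rw [prolong, iteratedDeriv_one, he]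
  exact (HasDerivAt.comp (0 : ℝ) (by simpa only [mul_zero, add_zero] using hd.hasDerivAt) hp).deriv

theorem prolong_two {U : TopologicalSpace.Opens ℝ} {h : ℝ → ℝ} (hh : ContDiffOn ℝ ∞ h U)
    {z : ℕ → ℝ} (hz : z 0 ∈ U) :
    prolong h z 2 = deriv (deriv h) (z 0) * z 1 ^ 2 + deriv h (z 0) * z 2 := by
  have hc : ∀ y ∈ U, ContDiffAt ℝ ∞ h y := fun y hy => hh.contDiffAt (U.isOpen.mem_nhds hy)
  have hc2 : DifferentiableAt ℝ (deriv h) (z 0) :=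
    ((hh.deriv_of_isOpen (m := ∞) U.isOpen (by simp)).contDiffAt
      (U.isOpen.mem_nhds hz)).differentiableAt (by simp)
  have hp : ∀ t : ℝ, HasDerivAt (fun t => z 0 + z 1 * t + z 2 / 2 * t ^ 2) (z 1 + z 2 * t) t := by
    intro t
    have h1 := (((hasDerivAt_id t).const_mul (z 1)).const_add (z 0)).add
      (((hasDerivAt_id t).pow 2).const_mul (z 2 / 2))
    refine h1.congr_deriv ?_
    simp
    ring
  have he : (fun t => h (taylorRep z 2 t)) = h ∘ fun t => z 0 + z 1 * t + z 2 / 2 * t ^ 2 := by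
    funext t
    simp [taylorRep, Finset.sum_range_succ]
  have hev : ∀ᶠ t in nhds (0 : ℝ), z 0 + z 1 * t + z 2 / 2 * t ^ 2 ∈ U :=
    (hp 0).continuousAt.eventually (U.isOpen.mem_nhds (by simpa using hz))
  have hd1 : deriv (h ∘ fun t => z 0 + z 1 * t + z 2 / 2 * t ^ 2) =ᶠ[nhds 0]
      fun t => deriv h (z 0 + z 1 * t + z 2 / 2 * t ^ 2) * (z 1 + z 2 * t) := by
    filter_upwards [hev] with t ht
    exact (HasDerivAt.comp t ((hc _ ht).differentiableAt (by simp)).hasDerivAt (hp t)).deriv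
  have hl : HasDerivAt (fun t : ℝ => z 1 + z 2 * t) (z 2) 0 := by
    simpa using ((hasDerivAt_id (0 : ℝ)).const_mul (z 2)).const_add (z 1)
  have hk : HasDerivAt (fun t => deriv h (z 0 + z 1 * t + z 2 / 2 * t ^ 2))
      (deriv (deriv h) (z 0) * (z 1 + z 2 * 0)) 0 :=
    HasDerivAt.comp (0 : ℝ) (h₂ := deriv h) (by simpa using hc2.hasDerivAt) (hp 0)
  rw [prolong, iteratedDeriv_succ, iteratedDeriv_one, he, hd1.deriv_eq]
  refine (hk.mul hl).deriv.trans ?_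
  simp
  ring

theorem extend_of_mem {I : Set ℕ} (x : I → ℝ) {p : ℕ} (hp : p ∈ I) : extend x p = x ⟨p, hp⟩ := by
  simp [extend, hp]

theorem frameSection_mem {I : Set ℕ} {U : TopologicalSpace.Opens ℝ} {x : I → ℝ}
    (hx : x ∈ frameDom I U) : frameSection x 0 ∈ U := hx

theorem tangent_toCoord {I : Set ℕ} {p : ℕ} (hp : p ∈ I) (z v : ℕ → ℝ) :
    extend (tangent (fun y (q : I) => toCoord y q) z v) p =
      deriv (fun t : ℝ => toCoord (z + t • v) p) 0 :=
  extend_of_mem _ hp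

theorem hasDerivAt_line (z v : ℕ → ℝ) (p : ℕ) :
    HasDerivAt (fun t : ℝ => (z + t • v) p) (v p) 0 := by
  simpa using ((hasDerivAt_id (0 : ℝ)).mul_const (v p)).const_add (z p)

theorem tangent_toCoord_zero {I : Set ℕ} (h0 : 0 ∈ I) (z v : ℕ → ℝ) :
    extend (tangent (fun y (q : I) => toCoord y q) z v) 0 = v 0 := by
  rw [tangent_toCoord h0]
  exact (hasDerivAt_line z v 0).deriv

theorem tangent_toCoord_one {I : Set ℕ} (h1 : 1 ∈ I) (z v : ℕ → ℝ) (hz : z 1 ≠ 0) :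
    extend (tangent (fun y (q : I) => toCoord y q) z v) 1 = v 1 / z 1 := by
  rw [tangent_toCoord h1]
  simp only [toCoord, Real.log_abs]
  refine ((hasDerivAt_line z v 1).log (by simpa using hz)).deriv.trans ?_
  simp

theorem tangent_toCoord_two {I : Set ℕ} (h2 : 2 ∈ I) (z v : ℕ → ℝ) (hz : z 1 ≠ 0) :
    extend (tangent (fun y (q : I) => toCoord y q) z v) 2 =
      v 2 / z 1 ^ 2 - 2 * z 2 * v 1 / z 1 ^ 3 := by
  rw [tangent_toCoord h2]
  refine ((hasDerivAt_line z v 2).div ((hasDerivAt_line z v 1).pow 2)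
    (by simpa using hz)).deriv.trans ?_
  simp
  field_simp

/-- The defining property of `cl1Form`: its pullback to the space of frames is `θ₂ ∧ θ₀`. -/
theorem pullback_cl1Form {I : Set ℕ} (h0 : 0 ∈ I) (h2 : 2 ∈ I) (z : ℕ → ℝ) (hz : z 1 ≠ 0)
    (v : Fin 2 → ℕ → ℝ) :
    pullback (fun y (q : I) => toCoord y q) (cl1Form I) z v = wedge ![theta 2, theta 0] z v := by
  simp only [pullback, cl1Form_apply, tangent_toCoord_zero h0, tangent_toCoord_two h2 _ _ hz,
    wedge, Matrix.det_fin_two, Matrix.of_apply, Matrix.cons_val_zero, Matrix.cons_val_one,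
    theta_zero, theta_two]
  field_simp
  ring

/-- The defining property of `gvlForm`: its pullback to the space of frames is
`θ₀ ∧ θ₁ ∧ θ₂`. -/
theorem pullback_gvlForm {I : Set ℕ} (h0 : 0 ∈ I) (h1 : 1 ∈ I) (h2 : 2 ∈ I) (z : ℕ → ℝ)
    (hz : z 1 ≠ 0) (v : Fin 3 → ℕ → ℝ) :
    pullback (fun y (q : I) => toCoord y q) (gvlForm I) z v =
      wedge ![theta 0, theta 1, theta 2] z v := by
  simp only [pullback, gvlForm_apply, Matrix.det_fin_three, Fin.val_zero, Fin.val_one,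
    Fin.val_two, Matrix.of_apply, tangent_toCoord_zero h0, tangent_toCoord_one h1 _ _ hz,
    tangent_toCoord_two h2 _ _ hz, wedge, Matrix.cons_val_zero, Matrix.cons_val_one,
    Matrix.cons_val, theta_zero, theta_one, theta_two]
  field_simp
  ring

section InducedMap

variable {I : Set ℕ} {U V : TopologicalSpace.Opens ℝ} (m : EtaleMap U V) {x : I → ℝ}

theorem eventually_mem_frameDom (hx : x ∈ frameDom I U) (v : I → ℝ) :
    ∀ᶠ t in nhds (0 : ℝ), x + t • v ∈ frameDom I U := by
  have hline : Continuous fun t : ℝ => x + t • v := by fun_prop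
  exact hline.continuousAt.eventually
    ((isOpen_frameDom I U).mem_nhds (by simpa using hx))

theorem EtaleMap.hasDerivAt {s : ℝ} (hs : s ∈ U) : HasDerivAt m.toFun (deriv m.toFun s) s :=
  ((m.contDiffOn.contDiffAt (U.isOpen.mem_nhds hs)).differentiableAt (by simp)).hasDerivAt

theorem EtaleMap.hasDerivAt_two {s : ℝ} (hs : s ∈ U) :
    HasDerivAt (deriv m.toFun) (deriv (deriv m.toFun) s) s :=
  (((m.contDiffOn.deriv_of_isOpen (m := ∞) U.isOpen (by simp)).contDiffAt
      (U.isOpen.mem_nhds hs)).differentiableAt (by simp)).hasDerivAt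

theorem EtaleMap.differentiableAt_two {s : ℝ} (hs : s ∈ U) :
    DifferentiableAt ℝ (deriv (deriv m.toFun)) s :=
  ((((m.contDiffOn.deriv_of_isOpen (m := ∞) U.isOpen (by simp)).deriv_of_isOpen (m := ∞)
    U.isOpen (by simp)).contDiffAt (U.isOpen.mem_nhds hs)).differentiableAt (by simp))

theorem coord_zero : toCoord (prolong m.toFun (frameSection x)) 0 = m.toFun (extend x 0) :=
  prolong_zero _ _

theorem coord_one (hx : x ∈ frameDom I U) : toCoord (prolong m.toFun (frameSection x)) 1 =
    Real.log (deriv m.toFun (extend x 0)) + extend x 1 := by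
  have h := prolong_one m.contDiffOn (frameSection_mem hx)
  have hne := m.deriv_ne_zero _ hx
  simp only [toCoord, h, Real.log_abs]
  simp only [frameSection, ofCoord]
  rw [Real.log_mul hne (Real.exp_pos _).ne', Real.log_exp]

theorem coord_two (hx : x ∈ frameDom I U) : toCoord (prolong m.toFun (frameSection x)) 2 =
    deriv (deriv m.toFun) (extend x 0) / deriv m.toFun (extend x 0) ^ 2 +
      extend x 2 / deriv m.toFun (extend x 0) := by
  have h := prolong_one m.contDiffOn (frameSection_mem hx)
  have h2 := prolong_two m.contDiffOn (frameSection_mem hx)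
  have hne := m.deriv_ne_zero _ hx
  have he := (Real.exp_pos (extend x 1)).ne'
  simp only [toCoord, zero_add, h, h2]
  simp only [frameSection, ofCoord]
  field_simp
  ring

theorem extend_tangent_induced {p : ℕ} (hp : p ∈ I) (h : ℝ → ℝ) (v : I → ℝ) :
    extend (tangent (induced I h) x v) p =
      deriv (fun t : ℝ => toCoord (prolong h (frameSection (x + t • v))) p) 0 :=
  extend_of_mem _ hp

theorem tangent_induced_zero (h0 : 0 ∈ I) (hx : x ∈ frameDom I U) (v : I → ℝ) :
    extend (tangent (induced I m.toFun) x v) 0 = deriv m.toFun (extend x 0) * extend v 0 := by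
  rw [extend_tangent_induced h0]
  simp only [coord_zero]
  exact (HasDerivAt.comp (0 : ℝ) (by simpa only [zero_smul, add_zero] using m.hasDerivAt hx)
    (hasDerivAt_extend x v 0)).deriv

theorem tangent_induced_one (h1 : 1 ∈ I) (hx : x ∈ frameDom I U) (v : I → ℝ) :
    extend (tangent (induced I m.toFun) x v) 1 =
      deriv (deriv m.toFun) (extend x 0) / deriv m.toFun (extend x 0) * extend v 0 +
        extend v 1 := by
  rw [extend_tangent_induced h1]
  have he : (fun t : ℝ => toCoord (prolong m.toFun (frameSection (x + t • v))) 1) =ᶠ[nhds 0]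
      fun t => Real.log (deriv m.toFun (extend (x + t • v) 0)) + extend (x + t • v) 1 := by
    filter_upwards [eventually_mem_frameDom hx v] with t ht
    exact coord_one m ht
  have hk : HasDerivAt (fun t : ℝ => deriv m.toFun (extend (x + t • v) 0))
      (deriv (deriv m.toFun) (extend x 0) * extend v 0) 0 :=
    HasDerivAt.comp (0 : ℝ) (h₂ := deriv m.toFun)
      (by simpa only [zero_smul, add_zero] using m.hasDerivAt_two hx) (hasDerivAt_extend x v 0)
  have hne : deriv m.toFun (extend (x + (0 : ℝ) • v) 0) ≠ 0 := by
    simpa using m.deriv_ne_zero _ hx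
  rw [he.deriv_eq]
  refine ((hk.log hne).add (hasDerivAt_extend x v 1)).deriv.trans ?_
  simp only [zero_smul, add_zero]
  ring

theorem tangent_induced_two (h2 : 2 ∈ I) (hx : x ∈ frameDom I U) : ∃ C : ℝ, ∀ v : I → ℝ,
    extend (tangent (induced I m.toFun) x v) 2 =
      C * extend v 0 + extend v 2 / deriv m.toFun (extend x 0) := by
  have hne := m.deriv_ne_zero _ hx
  obtain ⟨a, ha⟩ : ∃ a, HasDerivAt
      (fun s => deriv (deriv m.toFun) s / deriv m.toFun s ^ 2) a (extend x 0) :=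
    ⟨_, ((m.differentiableAt_two hx).div ((m.hasDerivAt_two hx).differentiableAt.pow 2)
      (pow_ne_zero 2 hne)).hasDerivAt⟩
  refine ⟨a - extend x 2 * deriv (deriv m.toFun) (extend x 0) / deriv m.toFun (extend x 0) ^ 2,
    fun v => ?_⟩
  rw [extend_tangent_induced h2]
  have he : (fun t : ℝ => toCoord (prolong m.toFun (frameSection (x + t • v))) 2) =ᶠ[nhds 0]
      fun t => deriv (deriv m.toFun) (extend (x + t • v) 0) /
        deriv m.toFun (extend (x + t • v) 0) ^ 2 +
        extend (x + t • v) 2 / deriv m.toFun (extend (x + t • v) 0) := by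
    filter_upwards [eventually_mem_frameDom hx v] with t ht
    exact coord_two m ht
  have hk : HasDerivAt (fun t : ℝ => deriv m.toFun (extend (x + t • v) 0))
      (deriv (deriv m.toFun) (extend x 0) * extend v 0) 0 :=
    HasDerivAt.comp (0 : ℝ) (h₂ := deriv m.toFun)
      (by simpa only [zero_smul, add_zero] using m.hasDerivAt_two hx) (hasDerivAt_extend x v 0)
  have hk2 : HasDerivAt (fun t : ℝ => deriv (deriv m.toFun) (extend (x + t • v) 0) /
      deriv m.toFun (extend (x + t • v) 0) ^ 2) (a * extend v 0) 0 :=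
    HasDerivAt.comp (0 : ℝ)
      (h₂ := fun s => deriv (deriv m.toFun) s / deriv m.toFun s ^ 2)
      (by simpa only [zero_smul, add_zero] using ha) (hasDerivAt_extend x v 0)
  have hne' : deriv m.toFun (extend (x + (0 : ℝ) • v) 0) ≠ 0 := by
    simpa using hne
  rw [he.deriv_eq]
  refine (hk2.add ((hasDerivAt_extend x v 2).div hk hne')).deriv.trans ?_
  simp only [zero_smul, add_zero]
  field_simp
  ring

theorem cl1Form_invariant (h0 : 0 ∈ I) (h2 : 2 ∈ I) (hx : x ∈ frameDom I U)
    (v : Fin 2 → I → ℝ) :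
    pullback (induced I m.toFun) (cl1Form I) x v = cl1Form I x v := by
  obtain ⟨C, hC⟩ := tangent_induced_two m h2 hx
  have hne := m.deriv_ne_zero _ hx
  simp only [pullback, cl1Form_apply, hC, tangent_induced_zero m h0 hx]
  field_simp
  ring

theorem gvlForm_invariant (h0 : 0 ∈ I) (h1 : 1 ∈ I) (h2 : 2 ∈ I) (hx : x ∈ frameDom I U)
    (v : Fin 3 → I → ℝ) :
    pullback (induced I m.toFun) (gvlForm I) x v = gvlForm I x v := by
  obtain ⟨C, hC⟩ := tangent_induced_two m h2 hx
  have hne := m.deriv_ne_zero _ hx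
  simp only [pullback, gvlForm_apply, Matrix.det_fin_three, Matrix.of_apply, Fin.val_zero,
    Fin.val_one, Fin.val_two, hC, tangent_induced_zero m h0 hx, tangent_induced_one m h1 hx]
  field_simp
  ring

end InducedMap

/-- The form `dx_{e 0} ∧ ⋯ ∧ dx_{e (k-1)}` is smooth. -/
theorem isSmoothOn_det {ι : Type} {k : ℕ} (e : Fin k → ι) (W : Set (ι → ℝ)) :
    IsSmoothOn (fun _ v => Matrix.det (Matrix.of fun i j => v j (e i))) W := by
  classical
  intro x _
  refine ⟨Finset.univ.image e, Set.univ, fun _ => Matrix.detRowAlternating.compLinearMap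
    (LinearMap.pi fun i => LinearMap.proj ⟨e i, Finset.mem_image_of_mem e (Finset.mem_univ i)⟩),
    isOpen_univ, trivial, fun _ => contDiffOn_const, fun y _ _ v => ?_⟩
  exact (Matrix.det_transpose (Matrix.of fun i j => v j (e i))).symm

theorem cl1Form_smooth {I : Set ℕ} (h0 : 0 ∈ I) (h2 : 2 ∈ I) (W : Set (I → ℝ)) :
    IsSmoothOn (cl1Form I) W := by
  have h := isSmoothOn_det ![(⟨2, h2⟩ : I), ⟨0, h0⟩] W
  convert h using 3 with x v
  simp [cl1Form_apply, Matrix.det_fin_two, extend_of_mem _ h0, extend_of_mem _ h2]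

theorem gvlForm_smooth {I : Set ℕ} (h0 : 0 ∈ I) (h1 : 1 ∈ I) (h2 : 2 ∈ I) (W : Set (I → ℝ)) :
    IsSmoothOn (gvlForm I) W := by
  have h := (isSmoothOn_det ![(⟨0, h0⟩ : I), ⟨1, h1⟩, ⟨2, h2⟩] W).smul (-1)
  convert h using 1
  funext x v
  simp [gvlForm_apply, Matrix.det_fin_three, extend_of_mem _ h0, extend_of_mem _ h1,
    extend_of_mem _ h2]

theorem extD_eq_zero_of_const {ι : Type} {k : ℕ} {σ : Form ι k} (h : ∀ x y v, σ x v = σ y v)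
    (x : ι → ℝ) (v : Fin (k + 1) → ι → ℝ) : extD σ x v = 0 := by
  refine Finset.sum_eq_zero fun i _ => ?_
  have : (fun y => σ y fun j => v (i.succAbove j)) = fun _ => σ x fun j => v (i.succAbove j) :=
    funext fun y => h _ _ _
  rw [this]
  simp only [lineDeriv, deriv_const, mul_zero]

/-! ### The characteristic classes -/

/-- The closed form `cl₁ = θ₂ ∧ θ₀` on `S'_N` of a `D₁`-space. -/
noncomputable def cl1 {X : Type u} (A : D1Space X) (N : ℕ∞) (hN : 2 ≤ N) :
    closedForms A (SPrime N) 2 :=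
  ⟨fun _ => cl1Form _, by
    have h0 : 0 ∈ (SPrime N).coords := ⟨by simp, by simp⟩
    have h2 : 2 ∈ (SPrime N).coords := ⟨by simpa using hN, by simp⟩
    refine ⟨⟨fun c => cl1Form_smooth h0 h2 _,
      fun c d m x hx v => cl1Form_invariant m.toEtaleMap h0 h2 hx v, fun c a _ x _ v => ?_⟩,
      fun c x _ v => extD_eq_zero_of_const (fun x y v => ?_) x v⟩
    · simp only [cl1Form_apply]
    · simp only [cl1Form_apply]⟩

/-- The closed form `gvl = θ₀ ∧ θ₁ ∧ θ₂` on `S''_N / ℤ` of a `D₁`-space. -/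
noncomputable def gvl {X : Type u} (A : D1Space X) (N : ℕ∞) (hN : 2 ≤ N) :
    closedForms A (SDoublePrimeModZ N) 3 :=
  ⟨fun _ => gvlForm _, by
    have h0 : 0 ∈ (SDoublePrimeModZ N).coords := by simp [SDoublePrimeModZ]
    have h1 : 1 ∈ (SDoublePrimeModZ N).coords := le_trans (by norm_num) hN
    have h2 : 2 ∈ (SDoublePrimeModZ N).coords := by simpa [SDoublePrimeModZ] using hN
    refine ⟨⟨fun c => gvlForm_smooth h0 h1 h2 _,
      fun c d m x hx v => gvlForm_invariant m.toEtaleMap h0 h1 h2 hx v, fun c a _ x _ v => ?_⟩,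
      fun c x _ v => extD_eq_zero_of_const (fun x y v => ?_) x v⟩
    · simp only [gvlForm_apply]
    · simp only [gvlForm_apply]⟩

/-- The first Chern–Losik class of a `D₁`-space in `H²(S'_N(X))`, `2 ≤ N ≤ ∞`. -/
noncomputable def chernLosikClass {X : Type u} (A : D1Space X) (N : ℕ∞) (hN : 2 ≤ N) :
    Cohomology A (SPrime N) 1 :=
  Submodule.Quotient.mk (cl1 A N hN)

/-- The Godbillon–Vey–Losik class of a `D₁`-space in `H³(S''_N(X)/ℤ)`, `2 ≤ N ≤ ∞`. -/
noncomputable def gvlClass {X : Type u} (A : D1Space X) (N : ℕ∞) (hN : 2 ≤ N) :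
    Cohomology A (SDoublePrimeModZ N) 2 :=
  Submodule.Quotient.mk (gvl A N hN)

end Losik

namespace Losik

universe u

/-! ### Forgetting coordinates -/

section Lift

variable {I J : Set ℕ}

/-! Suppose `dα = dx₂ ∧ dx₀` with `α` an invariant one-form on `S'_2`. Stability in `N` is
naturality: forgetting coordinates pulls invariant forms back to invariant forms and commutes with
`d`, so a primitive of order two remains a primitive in any higher order. This rests on
`proj_induced`: under an étale map, each of `x₀`, `x₁`, `x₂` is transformed by a formula that
involves only itself and `x₀`.

For the GVL class, the canonical form `θ₁` descends to `x₂ dx₀ - dx₁` on the quotient by `O(1)`. It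
is invariant under étale maps and under translations of `x₁`, and `dθ₁ = dx₂ ∧ dx₀`. Lift `α` to
`S''_2`; the primitive is `α ∧ θ₁`, because `d(α ∧ θ₁) = dα ∧ θ₁ - α ∧ dθ₁`. The first term is `dx₂
∧ dx₀ ∧ (x₂ dx₀ - dx₁) = -dx₀ ∧ dx₁ ∧ dx₂`. The second vanishes since `S'_2` has only the
coordinates `x₀`, `x₂`, so that `α` is a combination of `dx₀` and `dx₂`. This is where order two
matters: in higher order, `α` could contain `dx₃` and further differentials. The computation is
`extD_wedge_theta1Form`; `gvlClass_two_eq_zero` puts it together. -/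

/-- The projection that forgets the coordinates outside `I`. -/
def proj (hIJ : I ⊆ J) (x : J → ℝ) : I → ℝ := fun p => x ⟨p, hIJ p.2⟩

/-- The pullback of a form along the projection that forgets coordinates. -/
def liftForm (hIJ : I ⊆ J) {k : ℕ} (σ : Form I k) : Form J k :=
  fun x v => σ (proj hIJ x) fun i => proj hIJ (v i)

theorem extend_proj (hIJ : I ⊆ J) (x : J → ℝ) {p : ℕ} (hp : p ∈ I) :
    extend (proj hIJ x) p = extend x p := by
  rw [extend_of_mem _ hp, extend_of_mem _ (hIJ hp)]
  rfl

theorem proj_mem_frameDom (hIJ : I ⊆ J) (h0 : 0 ∈ I) {U : TopologicalSpace.Opens ℝ}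
    {x : J → ℝ} : proj hIJ x ∈ frameDom I U ↔ x ∈ frameDom J U := by
  simp only [frameDom, Set.mem_ofPred_eq, extend_proj hIJ x h0]

/-- Exterior derivatives are built from derivatives along lines, and the linear projection carries
lines to lines; hence the two sides agree by definition. -/
theorem extD_liftForm (hIJ : I ⊆ J) {k : ℕ} (σ : Form I k) (x : J → ℝ)
    (v : Fin (k + 1) → J → ℝ) : extD (liftForm hIJ σ) x v = liftForm hIJ (extD σ) x v :=
  rfl

/-- The finitely many coordinates that describe `σ` locally are also coordinates on the larger
space, so the same local model works after relabelling them through the inclusion. -/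
theorem IsSmoothOn.liftForm (hIJ : I ⊆ J) {k : ℕ} {σ : Form I k} {W : Set (I → ℝ)}
    (h : IsSmoothOn σ W) : IsSmoothOn (liftForm hIJ σ) (proj hIJ ⁻¹' W) := by
  classical
  intro x hx
  obtain ⟨s, O, η, hO, hxO, hη, he⟩ := h _ hx
  let t : Finset J := s.image (Set.inclusion hIJ)
  let L : (t → ℝ) →ₗ[ℝ] (s → ℝ) := LinearMap.pi fun i =>
    LinearMap.proj ⟨Set.inclusion hIJ i, Finset.mem_image_of_mem _ i.2⟩
  have hL : ContDiff ℝ ∞ L := contDiff_pi.2 fun i =>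
    contDiff_apply ℝ ℝ (⟨Set.inclusion hIJ i, Finset.mem_image_of_mem _ i.2⟩ : t)
  exact ⟨t, L ⁻¹' O, fun y => (η (L y)).compLinearMap L, hO.preimage hL.continuous, hxO,
    fun v => (hη _).comp hL.contDiffOn fun y hy => hy,
    fun y hy hyO v => he _ hy hyO _⟩

variable {U V : TopologicalSpace.Opens ℝ} (m : EtaleMap U V)

/-- The two sections may differ in `z₁`, since `x₁` is set to zero when absent from `I`. This is
harmless: by `coord_zero`, `coord_one` and `coord_two`, the new `x_p` with `p ≤ 2` depends only on
`x₀` and `x_p`. -/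
theorem proj_induced (hIJ : I ⊆ J) (h0 : 0 ∈ I) (hI : ∀ p ∈ I, p ≤ 2) {x : J → ℝ}
    (hx : x ∈ frameDom J U) :
    proj hIJ (induced J m.toFun x) = induced I m.toFun (proj hIJ x) := by
  have hx' := (proj_mem_frameDom hIJ h0).2 hx
  funext ⟨p, hp⟩
  change toCoord (prolong m.toFun (frameSection x)) p =
    toCoord (prolong m.toFun (frameSection (proj hIJ x))) p
  have := hI p hp
  interval_cases p
  · rw [coord_zero, coord_zero, extend_proj hIJ x h0]
  · rw [coord_one m hx, coord_one m hx', extend_proj hIJ x h0, extend_proj hIJ x hp]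
  · rw [coord_two m hx, coord_two m hx', extend_proj hIJ x h0, extend_proj hIJ x hp]

theorem proj_tangent_induced (hIJ : I ⊆ J) (h0 : 0 ∈ I) (hI : ∀ p ∈ I, p ≤ 2) {x : J → ℝ}
    (hx : x ∈ frameDom J U) (v : J → ℝ) :
    proj hIJ (tangent (induced J m.toFun) x v) =
      tangent (induced I m.toFun) (proj hIJ x) (proj hIJ v) := by
  funext p
  -- Both components are derivatives at `0` along a line, so agreement for small `t` suffices; such
  -- points stay in the open domain where `proj_induced` applies.
  refine Filter.EventuallyEq.deriv_eq ?_
  filter_upwards [eventually_mem_frameDom hx v] with t ht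
  exact congrFun (proj_induced m hIJ h0 hI ht) p

theorem pullback_liftForm (hIJ : I ⊆ J) (h0 : 0 ∈ I) (hI : ∀ p ∈ I, p ≤ 2) {k : ℕ}
    (σ : Form I k) {x : J → ℝ} (hx : x ∈ frameDom J U) (v : Fin k → J → ℝ) :
    pullback (induced J m.toFun) (liftForm hIJ σ) x v =
      liftForm hIJ (pullback (induced I m.toFun) σ) x v := by
  simp only [pullback, liftForm, proj_induced m hIJ h0 hI hx,
    proj_tangent_induced m hIJ h0 hI hx]

theorem liftForm_cl1Form (hIJ : I ⊆ J) (h0 : 0 ∈ I) (h2 : 2 ∈ I) :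
    liftForm hIJ (cl1Form I) = cl1Form J := by
  funext x v
  simp only [liftForm, cl1Form_apply, extend_proj hIJ _ h0, extend_proj hIJ _ h2]

theorem liftForm_gvlForm (hIJ : I ⊆ J) (h0 : 0 ∈ I) (h1 : 1 ∈ I) (h2 : 2 ∈ I) :
    liftForm hIJ (gvlForm I) = gvlForm J := by
  funext x v
  simp only [liftForm, gvlForm_apply, Matrix.det_fin_three, Matrix.of_apply, Fin.val_zero,
    Fin.val_one, Fin.val_two, extend_proj hIJ _ h0, extend_proj hIJ _ h1, extend_proj hIJ _ h2]

theorem proj_shift (hIJ : I ⊆ J) (a : ℝ) (x : J → ℝ) :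
    proj hIJ (shift a x) = shift a (proj hIJ x) :=
  rfl

theorem shift_of_one_notMem (h1 : 1 ∉ I) (a : ℝ) (x : I → ℝ) : shift a x = x := by
  funext p
  have hp : (p : ℕ) ≠ 1 := fun h => h1 (h ▸ p.2)
  simp [shift, hp]

end Lift

section LiftComplex

variable {X : Type u} {A : D1Space X} {B C : FrameQuotient}

/-- The alternative in `hdeck` covers both uses: raising the order with the deck group fixed, and
passing from `S'` to `S''/ℤ`. In the second case the deck group grows, but its translations move
only `x₁`, which the lifted form does not see. -/
theorem liftForm_mem_forms (hBC : B.coords ⊆ C.coords) (h0 : 0 ∈ B.coords)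
    (hB : ∀ p ∈ B.coords, p ≤ 2) (hdeck : C.deck ≤ B.deck ∨ 1 ∉ B.coords) {k : ℕ}
    {σ : A.charts → Form B.coords k} (hσ : σ ∈ forms A B k) :
    (fun c => liftForm hBC (σ c)) ∈ forms A C k := by
  obtain ⟨hs, hm, hd⟩ := hσ
  refine ⟨fun c x hx => ?_, fun c d m x hx v => ?_, fun c a ha x hx v => ?_⟩
  · have h := (hs c).liftForm hBC x ((proj_mem_frameDom hBC h0).2 hx)
    rwa [show proj hBC ⁻¹' frameDom B.coords c.1.dom = frameDom C.coords c.1.dom from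
      Set.ext fun y => proj_mem_frameDom hBC h0] at h
  · exact (pullback_liftForm m.toEtaleMap hBC h0 hB (σ d) hx v).trans
      (hm c d m _ ((proj_mem_frameDom hBC h0).2 hx) _)
  · simp only [liftForm, proj_shift]
    rcases hdeck with h | h
    · exact hd c a (h ha) _ ((proj_mem_frameDom hBC h0).2 hx) _
    · rw [shift_of_one_notMem h]

theorem liftForm_mem_exactForms (hBC : B.coords ⊆ C.coords) (h0 : 0 ∈ B.coords)
    (hB : ∀ p ∈ B.coords, p ≤ 2) (hdeck : C.deck ≤ B.deck ∨ 1 ∉ B.coords) {k : ℕ}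
    {σ : A.charts → Form B.coords (k + 1)} (hσ : σ ∈ exactForms A B k) :
    (fun c => liftForm hBC (σ c)) ∈ exactForms A C k := by
  obtain ⟨hσ, η, hη, hd⟩ := hσ
  exact ⟨liftForm_mem_forms hBC h0 hB hdeck hσ, _, liftForm_mem_forms hBC h0 hB hdeck hη,
    fun c x hx v => hd c _ ((proj_mem_frameDom hBC h0).2 hx) _⟩

end LiftComplex

/-! ### Exterior products of one-forms -/

/-- A determinant is a polynomial in its entries. The factors come with separate finite coordinate
sets and neighbourhoods; the union of the former and the intersection of the latter serve all of
them. -/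
theorem IsSmoothOn.wedge {ι : Type} {k : ℕ} {W : Set (ι → ℝ)} {α : Fin k → Form ι 1}
    (h : ∀ i, IsSmoothOn (α i) W) : IsSmoothOn (wedge α) W := by
  classical
  intro x hx
  choose s O η hO hxO hη he using fun i => h i x hx
  let t : Finset ι := Finset.univ.biUnion s
  have ht : ∀ i, s i ⊆ t := fun i => Finset.subset_biUnion_of_mem s (Finset.mem_univ i)
  refine ⟨t, ⋂ i, restrictLin (ht i) ⁻¹' O i, fun y => Matrix.detRowAlternating.compLinearMap
    (LinearMap.pi fun i => ((AlternatingMap.ofSubsingleton ℝ (s i → ℝ) ℝ (0 : Fin 1)).symm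
      (η i (restrictLin (ht i) y))).comp (restrictLin (ht i))), ?_, ?_, fun v => ?_,
    fun y hy hyO v => ?_⟩
  · exact isOpen_iInter_of_finite fun i =>
      (hO i).preimage (restrictLin_contDiff (ht i)).continuous
  · exact Set.mem_iInter.2 hxO
  · change ContDiffOn ℝ ∞ (fun y => Matrix.det (Matrix.of fun j i =>
      η i (restrictLin (ht i) y) fun _ => restrictLin (ht i) (v j))) _
    simp only [Matrix.det_apply]
    refine ContDiffOn.sum fun τ _ => ContDiffOn.const_smul _ (contDiffOn_prod fun j _ => ?_)
    exact (hη j _).comp (restrictLin_contDiff (ht j)).contDiffOn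
      fun y hy => Set.mem_iInter.1 hy j
  -- `wedge` indexes rows by forms, whereas `Matrix.detRowAlternating` is alternating in rows
  -- indexed by vectors.
  · refine (Matrix.det_transpose _).symm.trans ?_
    change Matrix.det _ = Matrix.det (Matrix.of fun j i =>
      η i (restrict (s i) y) fun _ => restrict (s i) (v j))
    congr 1
    ext j i
    exact he i y hy (Set.mem_iInter.1 hyO i) _

/-- Pullback and translation act on the determinant entry by entry, so invariance is inherited from
the factors. -/
theorem wedge_mem_forms {X : Type u} {A : D1Space X} {B : FrameQuotient} {k : ℕ}
    {α : Fin k → A.charts → Form B.coords 1} (h : ∀ i, α i ∈ forms A B 1) :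
    (fun c => wedge fun i => α i c) ∈ forms A B k := by
  refine ⟨fun c => IsSmoothOn.wedge fun i => (h i).1 c, fun c d m x hx v => ?_,
    fun c a ha x hx v => ?_⟩
  · exact congrArg Matrix.det (Matrix.ext fun i j => (h i).2.1 c d m x hx _)
  · exact congrArg Matrix.det (Matrix.ext fun i j => (h i).2.2 c a ha x hx _)

theorem wedge_two_apply {ι : Type} (α β : Form ι 1) (x : ι → ℝ) (v : Fin 2 → ι → ℝ) :
    wedge ![α, β] x v =
      α x (fun _ => v 0) * β x (fun _ => v 1) - α x (fun _ => v 1) * β x (fun _ => v 0) := by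
  simp [wedge, Matrix.det_fin_two]

theorem extD_one_apply {ι : Type} (α : Form ι 1) (x : ι → ℝ) (v : Fin 2 → ι → ℝ) :
    extD α x v = lineDeriv ℝ (fun y => α y fun _ => v 1) x (v 0) -
      lineDeriv ℝ (fun y => α y fun _ => v 0) x (v 1) := by
  simp [extD, Fin.sum_univ_two, Fin.succAbove, Subsingleton.elim _ (0 : Fin 1), sub_eq_add_neg]

theorem lineDeriv_mul_sub_mul {ι : Type} {a b c d : (ι → ℝ) → ℝ} {x w : ι → ℝ}
    (ha : LineDifferentiableAt ℝ a x w) (hb : LineDifferentiableAt ℝ b x w)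
    (hc : LineDifferentiableAt ℝ c x w) (hd : LineDifferentiableAt ℝ d x w) :
    lineDeriv ℝ (fun y => a y * b y - c y * d y) x w =
      lineDeriv ℝ a x w * b x + a x * lineDeriv ℝ b x w -
        (lineDeriv ℝ c x w * d x + c x * lineDeriv ℝ d x w) := by
  have h := ((HasDerivAt.mul ha.hasLineDerivAt hb.hasLineDerivAt).sub
    (HasDerivAt.mul hc.hasLineDerivAt hd.hasLineDerivAt)).deriv
  refine Eq.trans h ?_
  simp

/-- `d(α ∧ β) = dα ∧ β - α ∧ dβ` for one-forms. -/
theorem extD_wedge_two {ι : Type} {W : Set (ι → ℝ)} (hW : IsOpen W) {α β : Form ι 1}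
    (hα : IsSmoothOn α W) (hβ : IsSmoothOn β W) {x : ι → ℝ} (hx : x ∈ W)
    (v : Fin 3 → ι → ℝ) :
    extD (wedge ![α, β]) x v =
      (extD α x ![v 0, v 1] * β x (fun _ => v 2) - extD α x ![v 0, v 2] * β x (fun _ => v 1) +
        extD α x ![v 1, v 2] * β x (fun _ => v 0)) -
      (extD β x ![v 0, v 1] * α x (fun _ => v 2) - extD β x ![v 0, v 2] * α x (fun _ => v 1) +
        extD β x ![v 1, v 2] * α x (fun _ => v 0)) := by
  have hα' := fun u w => hα.lineDifferentiableAt hW hx u w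
  have hβ' := fun u w => hβ.lineDifferentiableAt hW hx u w
  have h00 : (0 : Fin 3).succAbove 0 = 1 := rfl
  have h01 : (0 : Fin 3).succAbove 1 = 2 := rfl
  have h10 : (1 : Fin 3).succAbove 0 = 0 := rfl
  have h11 : (1 : Fin 3).succAbove 1 = 2 := rfl
  have h20 : (2 : Fin 3).succAbove 0 = 0 := rfl
  have h21 : (2 : Fin 3).succAbove 1 = 1 := rfl
  rw [extD, Fin.sum_univ_three]
  simp only [wedge_two_apply, h00, h01, h10, h11, h20, h21, extD_one_apply,
    lineDeriv_mul_sub_mul (hα' _ _) (hβ' _ _) (hα' _ _) (hβ' _ _), Matrix.cons_val_zero,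
    Matrix.cons_val_one, Fin.val_zero, Fin.val_one, Fin.val_two]
  ring

/-! ### The canonical form `θ₁` on the quotient by `O(1)` -/

/-- The form `θ₁` in the coordinates `x_p`, `p ∈ I`. -/
noncomputable def theta1Form (I : Set ℕ) : Form I 1 := pullback frameSection (theta 1)

section ThetaOne

variable {I : Set ℕ}

theorem theta1Form_apply (x : I → ℝ) (v : Fin 1 → I → ℝ) :
    theta1Form I x v = extend x 2 * extend (v 0) 0 - extend (v 0) 1 := by
  have he := (Real.exp_pos (extend x 1)).ne'
  simp only [theta1Form, pullback, theta_one, tangent_frameSection_zero, tangent_frameSection_one]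
  simp only [frameSection, ofCoord]
  field_simp
  ring

/-- The coefficient `x₂` of `dx₀` varies, so the constant-coefficient lemma `isSmoothOn_det` does
not apply; a local model in the coordinates `x₀`, `x₁`, `x₂` is given directly. -/
theorem theta1Form_smooth (h0 : 0 ∈ I) (h1 : 1 ∈ I) (h2 : 2 ∈ I) (W : Set (I → ℝ)) :
    IsSmoothOn (theta1Form I) W := by
  classical
  intro x _
  let s : Finset I := {⟨0, h0⟩, ⟨1, h1⟩, ⟨2, h2⟩}
  let i0 : s := ⟨⟨0, h0⟩, by simp [s]⟩
  let i1 : s := ⟨⟨1, h1⟩, by simp [s]⟩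
  let i2 : s := ⟨⟨2, h2⟩, by simp [s]⟩
  refine ⟨s, Set.univ, fun y => AlternatingMap.ofSubsingleton ℝ (s → ℝ) ℝ (0 : Fin 1)
    (y i2 • LinearMap.proj i0 - LinearMap.proj i1), isOpen_univ, trivial, fun v => ?_,
    fun y _ _ v => ?_⟩
  · exact ((contDiff_apply ℝ ℝ i2).mul contDiff_const).sub contDiff_const |>.contDiffOn
  · rw [theta1Form_apply, extend_of_mem _ h0, extend_of_mem _ h1, extend_of_mem _ h2]
    rfl

/-- Under `h`, the term `x₂ dx₀` gains `(h''/h') dx₀` from the change of `x₂`; this is exactly `d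
log |h'|`, which `dx₁` gains as well, so the two cancel in `x₂ dx₀ - dx₁`. -/
theorem theta1Form_invariant {U V : TopologicalSpace.Opens ℝ} (m : EtaleMap U V) (h0 : 0 ∈ I)
    (h1 : 1 ∈ I) (h2 : 2 ∈ I) {x : I → ℝ} (hx : x ∈ frameDom I U) (v : Fin 1 → I → ℝ) :
    pullback (induced I m.toFun) (theta1Form I) x v = theta1Form I x v := by
  have hne := m.deriv_ne_zero _ hx
  have hc : extend (induced I m.toFun x) 2 = toCoord (prolong m.toFun (frameSection x)) 2 :=
    extend_of_mem _ h2
  simp only [pullback, theta1Form_apply, hc, coord_two m hx, tangent_induced_zero m h0 hx,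
    tangent_induced_one m h1 hx]
  field_simp
  ring

theorem extend_shift {p : ℕ} (hp : p ≠ 1) (a : ℝ) (x : I → ℝ) :
    extend (shift a x) p = extend x p := by
  unfold extend shift
  split_ifs <;> simp

theorem theta1Form_mem_forms {X : Type u} (A : D1Space X) {B : FrameQuotient}
    (h0 : 0 ∈ B.coords) (h1 : 1 ∈ B.coords) (h2 : 2 ∈ B.coords) :
    (fun _ => theta1Form B.coords) ∈ forms A B 1 :=
  ⟨fun _ => theta1Form_smooth h0 h1 h2 _,
    fun _ _ m _ hx v => theta1Form_invariant m.toEtaleMap h0 h1 h2 hx v,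
    -- The coefficients of `x₂ dx₀ - dx₁` do not involve `x₁`, so every translation of `x₁`
    -- preserves the form.
    fun c a _ x _ v => by simp only [theta1Form_apply, extend_shift (by decide : 2 ≠ 1)]⟩

/-- `dθ₁ = θ₂ ∧ θ₀`. -/
theorem extD_theta1Form (x : I → ℝ) (v : Fin 2 → I → ℝ) :
    extD (theta1Form I) x v = cl1Form I x v := by
  have h : ∀ u w : I → ℝ, lineDeriv ℝ (fun y => theta1Form I y fun _ => u) x w =
      extend w 2 * extend u 0 := by
    intro u w
    simp only [theta1Form_apply]
    exact (((hasDerivAt_extend x w 2).mul_const (extend u 0)).sub_const (extend u 1)).deriv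
  rw [extD_one_apply, h, h, cl1Form_apply]

end ThetaOne

/-! ### The Godbillon–Vey–Losik form as a differential -/

/-- A `Form` is an arbitrary function of tangent vectors; linearity at a point comes only from the
local model in the definition of smoothness. -/
theorem IsSmoothOn.exists_linear {ι : Type} {σ : Form ι 1} {W : Set (ι → ℝ)}
    (h : IsSmoothOn σ W) {x : ι → ℝ} (hx : x ∈ W) :
    ∃ L : (ι → ℝ) →ₗ[ℝ] ℝ, ∀ v, σ x (fun _ => v) = L v := by
  obtain ⟨s, O, η, -, hxO, -, he⟩ := h x hx
  let R : (ι → ℝ) →ₗ[ℝ] (s → ℝ) := LinearMap.pi fun i => LinearMap.proj i.1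
  exact ⟨((AlternatingMap.ofSubsingleton ℝ (s → ℝ) ℝ (0 : Fin 1)).symm
    (η (restrict s x))).comp R, fun v => he x hx hxO _⟩

/-- A one-form on `S'_2` is a combination of `dx₀` and `dx₂`. -/
theorem IsSmoothOn.exists_coeff {I : Set ℕ} (hI : ∀ p, p ∈ I ↔ p = 0 ∨ p = 2) {σ : Form I 1}
    {W : Set (I → ℝ)} (h : IsSmoothOn σ W) {x : I → ℝ} (hx : x ∈ W) :
    ∃ a b : ℝ, ∀ v, σ x (fun _ => v) = a * extend v 0 + b * extend v 2 := by
  classical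
  obtain ⟨L, hL⟩ := h.exists_linear hx
  have h0 : 0 ∈ I := (hI 0).2 (.inl rfl)
  have h2 : 2 ∈ I := (hI 2).2 (.inr rfl)
  -- The coefficients are the values on the coordinate vectors, which span the space because `I` has
  -- just two elements.
  refine ⟨L (Pi.single ⟨0, h0⟩ 1), L (Pi.single ⟨2, h2⟩ 1), fun v => ?_⟩
  have hv : v = extend v 0 • Pi.single ⟨0, h0⟩ 1 + extend v 2 • Pi.single ⟨2, h2⟩ 1 := by
    funext ⟨p, hp⟩
    rcases (hI p).1 hp with rfl | rfl
    · simp [extend_of_mem v h0]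
    · simp [extend_of_mem v h2]
  rw [hL]
  conv_lhs => rw [hv]
  simp only [map_add, map_smul, smul_eq_mul]
  ring

/-- If `dα = θ₂ ∧ θ₀` and `α` is a combination of `dx₀` and `dx₂`, then
`d(α ∧ θ₁) = θ₀ ∧ θ₁ ∧ θ₂`. -/
theorem extD_wedge_theta1Form {I : Set ℕ} (h0 : 0 ∈ I) (h1 : 1 ∈ I) (h2 : 2 ∈ I)
    {W : Set (I → ℝ)} (hW : IsOpen W) {α : Form I 1} (hα : IsSmoothOn α W) {x : I → ℝ}
    (hx : x ∈ W) (hd : ∀ v, extD α x v = cl1Form I x v)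
    (hc : ∃ a b : ℝ, ∀ v, α x (fun _ => v) = a * extend v 0 + b * extend v 2)
    (v : Fin 3 → I → ℝ) : extD (wedge ![α, theta1Form I]) x v = gvlForm I x v := by
  obtain ⟨a, b, hc⟩ := hc
  rw [extD_wedge_two hW hα (theta1Form_smooth h0 h1 h2 W) hx]
  -- With `α = a dx₀ + b dx₂` at `x`, the contribution of `α ∧ dθ₁` cancels identically. Pointwise
  -- `a`, `b` suffice, because the derivatives of `α` enter only through `hd`.
  simp only [hd, extD_theta1Form, hc, cl1Form_apply, theta1Form_apply, gvlForm_apply,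
    Matrix.det_fin_three, Matrix.of_apply, Matrix.cons_val_zero, Matrix.cons_val_one,
    Fin.val_zero, Fin.val_one, Fin.val_two]
  ring

/-! ### The characteristic classes -/

section Classes

variable {X : Type u} (A : D1Space X)

theorem chernLosikClass_eq_zero_iff {N : ℕ∞} (hN : 2 ≤ N) :
    chernLosikClass A N hN = 0 ↔ (fun _ => cl1Form _) ∈ exactForms A (SPrime N) 1 :=
  Submodule.Quotient.mk_eq_zero _

theorem gvlClass_eq_zero_iff {N : ℕ∞} (hN : 2 ≤ N) :
    gvlClass A N hN = 0 ↔ (fun _ => gvlForm _) ∈ exactForms A (SDoublePrimeModZ N) 2 :=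
  Submodule.Quotient.mk_eq_zero _

theorem mem_coords_SPrime_two (p : ℕ) : p ∈ (SPrime 2).coords ↔ p = 0 ∨ p = 2 := by
  have : ((p : ℕ∞) ≤ 2) ↔ p ≤ 2 := by exact_mod_cast Nat.cast_le (α := ℕ∞) (m := p) (n := 2)
  change ((p : ℕ∞) ≤ 2 ∧ p ≠ 1) ↔ _
  rw [this]
  omega

theorem mem_coords_SDoublePrimeModZ_two (p : ℕ) :
    p ∈ (SDoublePrimeModZ 2).coords ↔ p ≤ 2 := by
  change (p : ℕ∞) ≤ 2 ↔ _
  exact_mod_cast Nat.cast_le (α := ℕ∞) (m := p) (n := 2)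

theorem SPrime_coords_mono {M N : ℕ∞} (h : M ≤ N) : (SPrime M).coords ⊆ (SPrime N).coords :=
  fun _ hp => ⟨hp.1.trans h, hp.2⟩

theorem SDoublePrimeModZ_coords_mono {M N : ℕ∞} (h : M ≤ N) :
    (SDoublePrimeModZ M).coords ⊆ (SDoublePrimeModZ N).coords :=
  fun _ hp => le_trans hp h

theorem SPrime_coords_subset (N : ℕ∞) : (SPrime N).coords ⊆ (SDoublePrimeModZ N).coords :=
  fun _ hp => hp.1

theorem chernLosikClass_eq_zero_of_two (h : chernLosikClass A 2 le_rfl = 0) {N : ℕ∞}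
    (hN : 2 ≤ N) : chernLosikClass A N hN = 0 := by
  rw [chernLosikClass_eq_zero_iff] at h ⊢
  have h0 := (mem_coords_SPrime_two 0).2 (.inl rfl)
  have h2 := (mem_coords_SPrime_two 2).2 (.inr rfl)
  rw [← liftForm_cl1Form (SPrime_coords_mono hN) h0 h2]
  exact liftForm_mem_exactForms (C := SPrime N) _ h0
    (fun p hp => ((mem_coords_SDoublePrimeModZ_two p).1 hp.1)) (.inl le_rfl) h

theorem gvlClass_eq_zero_of_two (h : gvlClass A 2 le_rfl = 0) {N : ℕ∞} (hN : 2 ≤ N) :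
    gvlClass A N hN = 0 := by
  rw [gvlClass_eq_zero_iff] at h ⊢
  have hmem : ∀ p ≤ 2, p ∈ (SDoublePrimeModZ 2).coords := fun p =>
    (mem_coords_SDoublePrimeModZ_two p).2
  rw [← liftForm_gvlForm (SDoublePrimeModZ_coords_mono hN) (hmem 0 (by decide))
    (hmem 1 (by decide)) (hmem 2 le_rfl)]
  exact liftForm_mem_exactForms (C := SDoublePrimeModZ N) _ (hmem 0 (by decide))
    (fun p hp => (mem_coords_SDoublePrimeModZ_two p).1 hp) (.inl le_rfl) h

theorem gvlClass_two_eq_zero (h : chernLosikClass A 2 le_rfl = 0) : gvlClass A 2 le_rfl = 0 := by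
  rw [chernLosikClass_eq_zero_iff] at h
  rw [gvlClass_eq_zero_iff]
  obtain ⟨-, η, hη, hd⟩ := h
  have hmem : ∀ p ≤ 2, p ∈ (SDoublePrimeModZ 2).coords := fun p =>
    (mem_coords_SDoublePrimeModZ_two p).2
  have h0 := hmem 0 (by decide)
  have h1 := hmem 1 (by decide)
  have h2 := hmem 2 le_rfl
  have h0' := (mem_coords_SPrime_two 0).2 (.inl rfl)
  have h2' := (mem_coords_SPrime_two 2).2 (.inr rfl)
  have hsub := SPrime_coords_subset 2
  have hα : (fun c => liftForm hsub (η c)) ∈ forms A (SDoublePrimeModZ 2) 1 :=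
    liftForm_mem_forms hsub h0' (fun p hp => (mem_coords_SDoublePrimeModZ_two p).1 (hsub hp))
      -- The coordinate `x₁` is excluded from `S'_2`, so the lift is automatically `ℤ`-invariant.
      (.inr fun h => h.2 rfl) hη
  refine ⟨(gvl A 2 le_rfl).2.1, fun c => wedge ![liftForm hsub (η c), theta1Form _], ?_,
    fun c x hx v => ?_⟩
  · have hw := wedge_mem_forms (α := ![fun c => liftForm hsub (η c), fun _ => theta1Form _])
      (Fin.forall_fin_two.2 ⟨hα, theta1Form_mem_forms A h0 h1 h2⟩)
    convert hw using 3 with c i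
    funext i
    fin_cases i <;> rfl
  · have hx' := (proj_mem_frameDom hsub h0').2 hx
    refine extD_wedge_theta1Form h0 h1 h2 (isOpen_frameDom _ _) (hα.1 c) hx (fun w => ?_) ?_ v
    · rw [extD_liftForm, ← liftForm_cl1Form hsub h0' h2']
      exact hd c _ hx' _
    -- The decomposition has to be taken on `S'_2`, before lifting: only there is the absence of a
    -- `dx₁` term forced.
    · obtain ⟨a, b, hab⟩ := (hη.1 c).exists_coeff mem_coords_SPrime_two hx'
      refine ⟨a, b, fun w => (hab (proj hsub w)).trans ?_⟩
      rw [extend_proj hsub w h0', extend_proj hsub w h2']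

end Classes

end Losik

theorem mainTheorem10 {X : Type*} (A : Losik.D1Space X)
    (h : Losik.chernLosikClass A 2 le_rfl = 0) :
    Losik.chernLosikClass A ⊤ le_top = 0 ∧
      Losik.gvlClass A 2 le_rfl = 0 ∧
      Losik.gvlClass A ⊤ le_top = 0 :=
  have hgvl := Losik.gvlClass_two_eq_zero A h
  ⟨Losik.chernLosikClass_eq_zero_of_two A h _, hgvl, Losik.gvlClass_eq_zero_of_two A hgvl _⟩
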